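/- Let $m,n,s$ be natural numbers and let $\Sigma$ be an autonomous differential-algebraic Pfaffian system $$\frac{\partial y_i}{\partial x_j}=f_{ij}(\mathbf y)\ (1\le i\le n,\ 1\le j\le m),\qquad g_k(\mathbf y)=0\ (1\le k\le s),$$ with $f_{ij},g_k\in\mathbb C[\mathbf y]=\mathbb C[y_1,\dots,y_n]$. For $h\in\mathbb C[\mathbf y]$ put $D_j(h)=\sum_{i=1}^n \frac{\partial h}{\partial y_i}f_{ij}$. Let $\mathfrak F$ be the ideal generated by all the polynomials $D_j(f_{ik})-D_k(f_{ij})$. For an ideal $I\subseteq\mathbb C[\mathbf y]$ let $\widetilde I$ be the ideal generated by $I$ and the polynomials $D_j(f)$, where $1\le j\le m$ and $f$ runs over a system of generators of $I$ (the result does not depend on the chosen system). Define $$\mathfrak I_0=\sqrt{(g_1,\dots,g_s)},\qquad \mathfrak I_1=\sqrt{\mathfrak F+\widetilde{\mathfrak I_0}},\qquad \mathfrak I_{p+1}=\sqrt{\widetilde{\mathfrak I_p}}\ \ (p\ge 1),$$ let $\mathbb V_p\subseteq\mathbb C^n$ be the set of common zeros of $\mathfrak I_p$, and let $p_\infty$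 be the least integer $p\ge 0$ from which on the ascending chain $(\mathfrak I_p)_{p\ge 0}$ (equivalently, the descending chain $(\mathbb V_p)_{p\ge 0}$) is stationary. If, for some $p_0\ge 0$, $C$ is an irreducible component of $\mathbb V_{p_0}$ with $C\subseteq\mathbb V_{p_0+1}$, then $C$ is an irreducible component of $\mathbb V_{p_\infty}$. Moreover, $\mathbb V_{p_\infty}=\mathbb V_{n+1}$, and $p_\infty\le n+1$. (Irreducible components are taken in the Zariski topology of $\mathbb C^n$: they are the maximal irreducible, in particular nonempty, algebraic subsets.) -/

import Mathlib

open MvPolynomial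

/-- An autonomous differential-algebraic Pfaffian system over `ℂ` with independent variables
`x₁, …, xₘ`, differential unknowns `y₁, …, yₙ` and `s` algebraic constraints:
`∂yᵢ/∂xⱼ = f i j (y)` and `g k (y) = 0`. -/
structure AutPfaffianSystem (m n s : ℕ) where
  f : Fin n → Fin m → MvPolynomial (Fin n) ℂ
  g : Fin s → MvPolynomial (Fin n) ℂ

/-- A Zariski closed subset of `ℂⁿ`: the set of common zeros of a polynomial ideal. -/
def IsAlgebraicSet {n : ℕ} (S : Set (Fin n → ℂ)) : Prop :=
  ∃ I : Ideal (MvPolynomial (Fin n) ℂ), S = zeroLocus ℂ I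

/-- An irreducible algebraic set: a nonempty algebraic set that is not the union of two proper
algebraic subsets. -/
def IsIrreducibleAlgebraicSet {n : ℕ} (S : Set (Fin n → ℂ)) : Prop :=
  IsAlgebraicSet S ∧ S.Nonempty ∧
    ∀ A B : Set (Fin n → ℂ), IsAlgebraicSet A → IsAlgebraicSet B → S = A ∪ B → S = A ∨ S = B

/-- `C` is an irreducible component of `V`: a maximal irreducible algebraic subset of `V`. -/
def IsIrreducibleComponentOf {n : ℕ} (C V : Set (Fin n → ℂ)) : Prop :=
  Maximal (fun S : Set (Fin n → ℂ) => IsIrreducibleAlgebraicSet S ∧ S ⊆ V) C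

namespace AutPfaffianSystem

variable {m n s : ℕ}

/-- The total derivative `D_j(h) = ∑ᵢ f i j * ∂h/∂yᵢ` with respect to `xⱼ`, as a derivation. -/
noncomputable def totalDeriv (S : AutPfaffianSystem m n s) (j : Fin m) :
    Derivation ℂ (MvPolynomial (Fin n) ℂ) (MvPolynomial (Fin n) ℂ) :=
  ∑ i : Fin n, S.f i j • pderiv i

theorem totalDeriv_apply (S : AutPfaffianSystem m n s) (j : Fin m)
    (h : MvPolynomial (Fin n) ℂ) :
    S.totalDeriv j h = ∑ i : Fin n, pderiv i h * S.f i j := by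
  have key : ∀ t : Finset (Fin n),
      (∑ i ∈ t, S.f i j • pderiv i :
        Derivation ℂ (MvPolynomial (Fin n) ℂ) (MvPolynomial (Fin n) ℂ)) h =
      ∑ i ∈ t, pderiv i h * S.f i j := by
    intro t
    induction t using Finset.induction_on with
    | empty => simp
    | insert a t ha ih =>
      rw [Finset.sum_insert ha, Finset.sum_insert ha, Derivation.add_apply, ih,
        Derivation.smul_apply, smul_eq_mul, mul_comm]
  exact key Finset.univ

/-- The ideal generated by the Frobenius conditions `D_j(f i k) - D_k(f i j)`. -/
noncomputable def frobeniusIdeal (S : AutPfaffianSystem m n s) : Ideal (MvPolynomial (Fin n) ℂ) :=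
  Ideal.span {h | ∃ (i : Fin n) (j k : Fin m),
    h = S.totalDeriv j (S.f i k) - S.totalDeriv k (S.f i j)}

/-- The prolongation of an ideal `I`: the ideal generated by `I` and the total derivatives of a
system of generators of `I`. All of `I` is taken as the system of generators;
`prolongation_eq_of_span_eq` shows that any other system of generators gives the same ideal. -/
noncomputable def prolongation (S : AutPfaffianSystem m n s)
    (I : Ideal (MvPolynomial (Fin n) ℂ)) : Ideal (MvPolynomial (Fin n) ℂ) :=
  I ⊔ Ideal.span {h | ∃ a ∈ I, ∃ j : Fin m, h = S.totalDeriv j a}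

theorem prolongation_eq_of_span_eq (S : AutPfaffianSystem m n s)
    (I : Ideal (MvPolynomial (Fin n) ℂ)) (F : Set (MvPolynomial (Fin n) ℂ))
    (hF : Ideal.span F = I) :
    S.prolongation I = I ⊔ Ideal.span {h | ∃ a ∈ F, ∃ j : Fin m, h = S.totalDeriv j a} := by
  subst hF
  apply le_antisymm
  · refine sup_le le_sup_left (Ideal.span_le.2 ?_)
    rintro _ ⟨a, ha, j, rfl⟩
    rw [SetLike.mem_coe]
    induction ha using Submodule.span_induction with
    | mem x hx => exact Ideal.mem_sup_right (Ideal.subset_span ⟨x, hx, j, rfl⟩)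
    | zero => simp
    | add x y _ _ hx hy => rw [map_add]; exact Ideal.add_mem _ hx hy
    | smul c x hx h =>
      rw [smul_eq_mul, Derivation.leibniz]
      exact Ideal.add_mem _ (Ideal.mul_mem_left _ c h)
        (Ideal.mul_mem_right _ _ (Ideal.mem_sup_left hx))
  · refine sup_le_sup_left (Ideal.span_mono ?_) _
    rintro _ ⟨a, ha, j, rfl⟩
    exact ⟨a, Ideal.subset_span ha, j, rfl⟩

/-- The ascending chain of radical ideals `I₀ ⊆ I₁ ⊆ ⋯` attached to the system. -/
noncomputable def idealChain (S : AutPfaffianSystem m n s) : ℕ → Ideal (MvPolynomial (Fin n) ℂ)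
  | 0 => (Ideal.span (Set.range S.g)).radical
  | 1 => (S.frobeniusIdeal ⊔ S.prolongation (Ideal.span (Set.range S.g)).radical).radical
  | p + 2 => (S.prolongation (idealChain S (p + 1))).radical

/-- The variety `V_p ⊆ ℂⁿ` of zeros of the `p`-th ideal of the chain. -/
def variety (S : AutPfaffianSystem m n s) (p : ℕ) : Set (Fin n → ℂ) :=
  zeroLocus ℂ (S.idealChain p)

theorem idealChain_monotone (S : AutPfaffianSystem m n s) : Monotone S.idealChain := by
  refine monotone_nat_of_le_succ fun p => ?_
  match p with
  | 0 => exact (le_sup_left.trans le_sup_right).trans Ideal.le_radical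
  | p + 1 => exact le_sup_left.trans Ideal.le_radical

theorem exists_stationary (S : AutPfaffianSystem m n s) :
    ∃ p, ∀ q, p ≤ q → S.idealChain q = S.idealChain p := by
  obtain ⟨p, hp⟩ := monotone_stabilizes_iff_noetherian.2
    (inferInstance : IsNoetherian (MvPolynomial (Fin n) ℂ) (MvPolynomial (Fin n) ℂ))
    ⟨S.idealChain, S.idealChain_monotone⟩
  exact ⟨p, fun q hq => (hp q hq).symm⟩

open Classical in
/-- The least index from which on the chain is stationary. -/
noncomputable def pInfty (S : AutPfaffianSystem m n s) : ℕ :=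
  Nat.find S.exists_stationary

end AutPfaffianSystem

/-! By the Nullstellensatz, components of `V_p` correspond to minimal primes `P` of `I_p`. If
`I_{p+1} ≤ P`, every `D_j` maps `I_p` into `P`. As `I_p` is radical, it agrees with `P` locally at
`P`, so every `D_j` preserves `P`, and `P` absorbs the whole chain
(`idealChain_le_of_mem_minimalPrimes`). For the bound, a minimal prime of `I_p` not containing
`I_{p+1}` sits atop a strict chain of such primes, one for each earlier index, so its height is at
least `p`. Heights are at most `n`, so none exists for `p = n + 1`. -/

/-- A minimal prime `P` of a radical ideal `I` agrees with `I` locally at `P`. -/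
theorem Ideal.IsRadical.exists_notMem_mul_mem {R : Type*} [CommRing R] {I P : Ideal R}
    (hI : I.IsRadical) (hP : P ∈ I.minimalPrimes) {a : R} (ha : a ∈ P) :
    ∃ t ∉ P, t * a ∈ I := by
  have : P.IsPrime := hP.1.1
  have hmem := Ideal.mem_map_of_mem (algebraMap R (Localization.AtPrime P)) ha
  rw [← IsLocalization.AtPrime.radical_map_of_mem_minimalPrimes (Localization.AtPrime P) P I hP]
    at hmem
  obtain ⟨k, hk⟩ := hmem
  rw [← map_pow, IsLocalization.algebraMap_mem_map_algebraMap_iff P.primeCompl] at hk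
  obtain ⟨t, ht, h⟩ := hk
  -- Exponent `k + 1` rather than `k`: a factor `t` is needed even when `k = 0`.
  refine ⟨t, ht, hI ⟨k + 1, ?_⟩⟩
  have : (t * a) ^ (k + 1) = t ^ k * a * (t * a ^ k) := by ring
  rw [this]
  exact I.mul_mem_left _ h

/-- If a derivation maps a radical ideal into one of its minimal primes, then it preserves that
minimal prime. -/
theorem Derivation.mem_of_mem_minimalPrimes {k R : Type*} [CommRing k] [CommRing R] [Algebra k R]
    (D : Derivation k R R) {I P : Ideal R} (hI : I.IsRadical) (hP : P ∈ I.minimalPrimes)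
    (hD : ∀ a ∈ I, D a ∈ P) {a : R} (ha : a ∈ P) : D a ∈ P := by
  obtain ⟨t, ht, hta⟩ := hI.exists_notMem_mul_mem hP ha
  have h := hD _ hta
  -- Modulo `P`, `D (t * a)` is `t * D a`, and `t ∉ P` can be cancelled.
  rw [Derivation.leibniz, smul_eq_mul, smul_eq_mul] at h
  exact (hP.1.1.mem_or_mem ((Ideal.add_mem_iff_left _ (P.mul_mem_right _ ha)).1 h)).resolve_left ht

namespace MvPolynomial

variable {n : ℕ}

theorem zeroLocus_inf_eq_union {k K σ : Type*} [Field k] [Field K] [Algebra k K]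
    (I J : Ideal (MvPolynomial σ k)) :
    zeroLocus K (I ⊓ J) = zeroLocus K I ∪ zeroLocus K J := by
  refine Set.Subset.antisymm (fun x hx => ?_) (Set.union_subset
    (zeroLocus_anti_mono inf_le_left) (zeroLocus_anti_mono inf_le_right))
  by_contra h
  simp only [Set.mem_union, not_or, mem_zeroLocus_iff, not_forall] at h
  obtain ⟨⟨a, ha, hax⟩, b, hb, hbx⟩ := h
  refine mul_ne_zero hax hbx ?_
  rw [← map_mul]
  exact hx _ ⟨I.mul_mem_right _ ha, J.mul_mem_left _ hb⟩

theorem isIrreducibleAlgebraicSet_zeroLocus (P : Ideal (MvPolynomial (Fin n) ℂ)) [hP : P.IsPrime] :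
    IsIrreducibleAlgebraicSet (zeroLocus ℂ P) := by
  refine ⟨⟨P, rfl⟩, ?_, ?_⟩
  · rw [Set.nonempty_iff_ne_empty]
    intro h
    apply hP.ne_top
    rw [← IsPrime.vanishingIdeal_zeroLocus (K := ℂ) P, h, vanishingIdeal_empty]
  · rintro _ _ ⟨I, rfl⟩ ⟨J, rfl⟩ h
    have hle : I ⊓ J ≤ P := by
      rw [← IsPrime.vanishingIdeal_zeroLocus (K := ℂ) P, h, ← zeroLocus_inf_eq_union]
      exact le_vanishingIdeal_zeroLocus _
    rcases hP.inf_le.1 hle with hI | hJ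
    · exact .inl ((zeroLocus_anti_mono hI).antisymm (h ▸ Set.subset_union_left))
    · exact .inr ((zeroLocus_anti_mono hJ).antisymm (h ▸ Set.subset_union_right))

end MvPolynomial

section

variable {n : ℕ}

theorem IsAlgebraicSet.zeroLocus_vanishingIdeal {C : Set (Fin n → ℂ)} (hC : IsAlgebraicSet C) :
    zeroLocus ℂ (vanishingIdeal ℂ C) = C := by
  obtain ⟨I, rfl⟩ := hC
  exact (zeroLocus_anti_mono (le_vanishingIdeal_zeroLocus I)).antisymm
    (zeroLocus_vanishingIdeal_le _)

theorem IsIrreducibleAlgebraicSet.isPrime_vanishingIdeal {C : Set (Fin n → ℂ)}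
    (hC : IsIrreducibleAlgebraicSet C) : (vanishingIdeal ℂ C).IsPrime := by
  obtain ⟨halg, ⟨x, hx⟩, hirr⟩ := hC
  refine ⟨fun h => ?_, fun {a b} hab => ?_⟩
  · have h1 : (1 : MvPolynomial (Fin n) ℂ) ∈ vanishingIdeal ℂ C := h ▸ Submodule.mem_top
    simpa using h1 x hx
  · have key : ∀ c : MvPolynomial (Fin n) ℂ,
        C = zeroLocus ℂ (vanishingIdeal ℂ C ⊔ Ideal.span {c}) → c ∈ vanishingIdeal ℂ C :=
      fun c hc y hy => (hc ▸ hy : y ∈ zeroLocus ℂ (vanishingIdeal ℂ C ⊔ Ideal.span {c})) c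
        (Ideal.mem_sup_right (Ideal.mem_span_singleton_self c))
    have hsub : ∀ c : MvPolynomial (Fin n) ℂ,
        zeroLocus ℂ (vanishingIdeal ℂ C ⊔ Ideal.span {c}) ⊆ C := fun c =>
      (zeroLocus_anti_mono le_sup_left).trans halg.zeroLocus_vanishingIdeal.le
    refine (hirr _ _ ⟨_, rfl⟩ ⟨_, rfl⟩ (Set.Subset.antisymm (fun y hy => ?_)
      (Set.union_subset (hsub a) (hsub b)))).imp (key a) (key b)
    have hy0 : aeval y a * aeval y b = 0 := by rw [← map_mul]; exact hab y hy
    have hmem : ∀ c : MvPolynomial (Fin n) ℂ, aeval y c = 0 →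
        y ∈ zeroLocus ℂ (vanishingIdeal ℂ C ⊔ Ideal.span {c}) := by
      intro c hc
      have hle : vanishingIdeal ℂ C ⊔ Ideal.span {c} ≤ vanishingIdeal ℂ {y} :=
        sup_le (vanishingIdeal_anti_mono (Set.singleton_subset_iff.2 hy))
          ((Ideal.span_singleton_le_iff_mem _).2 ((mem_vanishingIdeal_singleton_iff y c).2 hc))
      exact fun p hp => (mem_vanishingIdeal_singleton_iff y p).1 (hle hp)
    exact (mul_eq_zero.1 hy0).imp (hmem a) (hmem b)

theorem IsIrreducibleComponentOf.vanishingIdeal_mem_minimalPrimes {C : Set (Fin n → ℂ)}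
    {I : Ideal (MvPolynomial (Fin n) ℂ)} (hC : IsIrreducibleComponentOf C (zeroLocus ℂ I)) :
    vanishingIdeal ℂ C ∈ I.minimalPrimes := by
  have hprime := hC.prop.1.isPrime_vanishingIdeal
  obtain ⟨Q, hQ, hQle⟩ := Ideal.exists_minimalPrimes_le
    (le_zeroLocus_iff_le_vanishingIdeal.1 hC.prop.2)
  have : Q.IsPrime := hQ.1.1
  have heq : C = zeroLocus ℂ Q :=
    hC.eq_of_le ⟨isIrreducibleAlgebraicSet_zeroLocus Q, zeroLocus_anti_mono hQ.1.2⟩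
      (le_zeroLocus_iff_le_vanishingIdeal.2 hQle)
  rwa [heq, IsPrime.vanishingIdeal_zeroLocus]

theorem IsIrreducibleComponentOf.of_subset {C V W : Set (Fin n → ℂ)}
    (hC : IsIrreducibleComponentOf C V) (hWV : W ⊆ V) (hCW : C ⊆ W) :
    IsIrreducibleComponentOf C W :=
  ⟨⟨hC.prop.1, hCW⟩, fun _ hA hle => hC.2 ⟨hA.1, hA.2.trans hWV⟩ hle⟩

end

namespace AutPfaffianSystem

variable {m n s : ℕ} (S : AutPfaffianSystem m n s)

theorem isRadical_idealChain (p : ℕ) : (S.idealChain p).IsRadical := by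
  match p with
  | 0 => exact Ideal.radical_isRadical _
  | 1 => exact Ideal.radical_isRadical _
  | p + 2 => exact Ideal.radical_isRadical _

theorem prolongation_idealChain_le (p : ℕ) :
    S.prolongation (S.idealChain p) ≤ S.idealChain (p + 1) := by
  match p with
  | 0 => exact le_sup_right.trans Ideal.le_radical
  | p + 1 => exact Ideal.le_radical

theorem totalDeriv_mem_idealChain_succ {p : ℕ} {a : MvPolynomial (Fin n) ℂ}
    (ha : a ∈ S.idealChain p) (j : Fin m) : S.totalDeriv j a ∈ S.idealChain (p + 1) :=
  S.prolongation_idealChain_le p (Ideal.mem_sup_right (Ideal.subset_span ⟨a, ha, j, rfl⟩))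

variable {S}

/-- A minimal prime of a member of the chain that contains the next member contains all of
them. -/
theorem idealChain_le_of_mem_minimalPrimes {p : ℕ} {P : Ideal (MvPolynomial (Fin n) ℂ)}
    (hP : P ∈ (S.idealChain p).minimalPrimes) (hle : S.idealChain (p + 1) ≤ P) (q : ℕ) :
    S.idealChain q ≤ P := by
  have hprime : P.IsPrime := hP.1.1
  have hD : ∀ a ∈ P, ∀ j, S.totalDeriv j a ∈ P := fun a ha j =>
    (S.totalDeriv j).mem_of_mem_minimalPrimes (S.isRadical_idealChain p) hP
      (fun b hb => hle (S.totalDeriv_mem_idealChain_succ hb j)) ha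
  induction q with
  | zero => exact (S.idealChain_monotone (Nat.zero_le _)).trans hle
  | succ q ih =>
    match q with
    -- The Frobenius conditions enter here; they already lie in `I_{p+1}`.
    | 0 => exact (S.idealChain_monotone (Nat.le_add_left _ _)).trans hle
    | q + 1 =>
      refine hprime.radical_le_iff.2 (sup_le ih (Ideal.span_le.2 ?_))
      rintro _ ⟨a, ha, j, rfl⟩
      exact hD a (ih ha) j

/-- If `Q ≤ P` contained `I_{p+1}`, it would absorb the chain, and so would `P`. The inclusion is
strict since `P` does contain `I_{p+1}`. -/
theorem exists_lt_of_mem_minimalPrimes {p : ℕ} {P : Ideal (MvPolynomial (Fin n) ℂ)}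
    (hP : P ∈ (S.idealChain (p + 1)).minimalPrimes) (hnot : ¬ S.idealChain (p + 2) ≤ P) :
    ∃ Q ∈ (S.idealChain p).minimalPrimes, ¬ S.idealChain (p + 1) ≤ Q ∧ Q < P := by
  have hprime : P.IsPrime := hP.1.1
  obtain ⟨Q, hQ, hQP⟩ := Ideal.exists_minimalPrimes_le
    ((S.idealChain_monotone (Nat.le_add_right p 1)).trans hP.1.2)
  have hQnot : ¬ S.idealChain (p + 1) ≤ Q := fun h =>
    hnot ((idealChain_le_of_mem_minimalPrimes hQ h (p + 2)).trans hQP)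
  exact ⟨Q, hQ, hQnot, lt_of_le_of_ne hQP fun h => hQnot (h ▸ hP.1.2)⟩

theorem le_height_of_mem_minimalPrimes (p : ℕ) {P : Ideal (MvPolynomial (Fin n) ℂ)}
    (hP : P ∈ (S.idealChain p).minimalPrimes) (hnot : ¬ S.idealChain (p + 1) ≤ P) :
    (p : ℕ∞) ≤ P.height := by
  induction p generalizing P with
  | zero => simp
  | succ p ih =>
    obtain ⟨Q, hQ, hQnot, hlt⟩ := exists_lt_of_mem_minimalPrimes hP hnot
    have : P.IsPrime := hP.1.1
    have : Q.IsPrime := hQ.1.1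
    push_cast
    exact (add_le_add_left (ih hQ hQnot) 1).trans (Ideal.height_add_one_le_of_lt_of_isPrime hlt)

variable (S)

theorem idealChain_le_idealChain_succ_dim (q : ℕ) :
    S.idealChain q ≤ S.idealChain (n + 1) := by
  -- A radical ideal is the intersection of its minimal primes, so each can be tested separately.
  rw [← (S.isRadical_idealChain (n + 1)).radical, ← Ideal.sInf_minimalPrimes]
  refine le_sInf fun P hP => ?_
  have hprime : P.IsPrime := hP.1.1
  by_contra hq
  have hnot : ¬ S.idealChain (n + 1 + 1) ≤ P := fun h =>
    hq (idealChain_le_of_mem_minimalPrimes hP h q)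
  have hheight := le_height_of_mem_minimalPrimes _ hP hnot
  have hdim := Ideal.height_le_ringKrullDim_of_ne_top hprime.ne_top
  rw [ringKrullDim_of_isNoetherianRing, ringKrullDim_eq_zero_of_field, zero_add, Nat.card_fin] at hdim
  have h : (P.height : ℕ∞) ≤ (n : ℕ∞) := by exact_mod_cast hdim
  have := hheight.trans h
  norm_cast at this
  omega

theorem idealChain_eq_idealChain_pInfty {q : ℕ} (hq : S.pInfty ≤ q) :
    S.idealChain q = S.idealChain S.pInfty := by
  classical
  exact Nat.find_spec S.exists_stationary q hq

theorem pInfty_le : S.pInfty ≤ n + 1 := by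
  classical
  exact Nat.find_min' S.exists_stationary fun q hq =>
    (S.idealChain_le_idealChain_succ_dim q).antisymm (S.idealChain_monotone hq)

theorem idealChain_le_idealChain_pInfty (q : ℕ) : S.idealChain q ≤ S.idealChain S.pInfty :=
  (S.idealChain_monotone (le_max_left q S.pInfty)).trans
    (S.idealChain_eq_idealChain_pInfty (le_max_right _ _)).le

end AutPfaffianSystem

theorem proposition2p9 {m n s : ℕ} (S : AutPfaffianSystem m n s) :
    (∀ (p₀ : ℕ) (C : Set (Fin n → ℂ)),
      IsIrreducibleComponentOf C (S.variety p₀) → C ⊆ S.variety (p₀ + 1) →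
        IsIrreducibleComponentOf C (S.variety S.pInfty)) ∧
    S.variety S.pInfty = S.variety (n + 1) ∧
    S.pInfty ≤ n + 1 := by
  refine ⟨fun p₀ C hC hsub => ?_, ?_, S.pInfty_le⟩
  · refine hC.of_subset (zeroLocus_anti_mono (S.idealChain_le_idealChain_pInfty p₀)) ?_
    exact le_zeroLocus_iff_le_vanishingIdeal.2
      (AutPfaffianSystem.idealChain_le_of_mem_minimalPrimes hC.vanishingIdeal_mem_minimalPrimes
        (le_zeroLocus_iff_le_vanishingIdeal.1 hsub) _)
  · exact congrArg (zeroLocus ℂ) (S.idealChain_eq_idealChain_pInfty S.pInfty_le).symm
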